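/- Let $A=(a_k)_{k\in\mathbb Z}$ and $B=(b_k)_{k\in\mathbb Z}$ be sequences of complex numbers with $a_k=o(|k|^\alpha)$ and $b_k=o(|k|^\beta)$ as $k\to\pm\infty$, where $\alpha,\beta<1$ are real. For a sequence $A$ as above and integers $j\ge1$, $n\ge 1$, put (infinite series being limits of partial sums) $$D^{(A)}(1)=0,\qquad D^{(A)}(j)=\sum_{k=1}^\infty\frac{a_k}{k^j}\quad(j>1),$$ $$\widehat t^{(A)}(1)=\sum_{k=1}^\infty\Big(\frac{a_{k-1}}{k-1/2}-\frac{a_k}{k}\Big),\quad \widehat t^{(A)}(j)=\sum_{k=1}^\infty\frac{a_{k-1}}{(k-1/2)^j}\quad(j>1),$$ $$\widetilde t^{(A)}(1)=\sum_{k=1}^\infty\Big(\frac{a_{k}}{k-1/2}-\frac{a_k}{k}\Big),\quad \widetilde t^{(A)}(j)=\sum_{k=1}^\infty\frac{a_{k}}{(k-1/2)^j}\quad(j>1),$$ and, for $m\ge0$, $$\widehat E^{(A)}_m(j)=\sum_{k=1}^m\frac{a_{m-k}}{(k-1/2)^j},\qquad \widetilde E^{(A)}_m(j)=\sum_{k=1}^m\frac{a_{k-m-1}}{(k-1/2)^j},$$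 $$\widehat F^{(A)}_m(1)=\sum_{k=1}^\infty\Big(\frac{a_{k+m}}{k-1/2}-\frac{a_k}{k}\Big),\quad \widehat F^{(A)}_m(j)=\sum_{k=1}^\infty\frac{a_{k+m}}{(k-1/2)^j}\quad(j>1),$$ $$\widetilde F^{(A)}_m(1)=\sum_{k=1}^\infty\Big(\frac{a_{k-m}}{k-1/2}-\frac{a_k}{k}\Big),\quad \widetilde F^{(A)}_m(j)=\sum_{k=1}^\infty\frac{a_{k-m}}{(k-1/2)^j}\quad(j>1),$$ $$N^{(A)}_n(j)=\widehat E^{(A)}_n(j)+(-1)^j\widehat F^{(A)}_{n-1}(j),\qquad \bar N^{(A)}_n(j)=\widetilde F^{(A)}_n(j)-\widetilde E^{(A)}_{n-1}(j),$$ $$S^{(A)}_n(j)=N^{(A)}_n(j)+\bar N^{(A)}_n(j)-\frac{a_0}{(n-1/2)^j}.$$ Let $p>0$ and $q>1$ be integers with $\alpha+\beta<q-1$ (this is automatic if $q\ge3$). Then the infinite series over $n$ below converge absolutely, and $$\begin{aligned} &(-1)^{p+q}\sum_{n=1}^\infty\frac{\bar N^{(B)}_n(p)}{(n-1/2)^q}\,a_{n-1}+\sum_{n=1}^\infty\frac{N^{(B)}_n(p)}{(n-1/2)^q}\,a_n\\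 &-(-1)^p\sum_{k=0}^{p-1}\binom{p+q-k-2}{q-1}\sum_{n=1}^\infty\frac{b_n\,S^{(A)}_{n+1}(k+1)}{n^{p+q-k-1}}\\ &-b_0\Big((-1)^{p+q}\,\widehat t^{(A)}(p+q)+\widetilde t^{(A)}(p+q)\Big)\\ &+(-1)^p\sum_{k=1}^q\binom{k+p-2}{p-1}D^{(B)}(k+p-1)\Big((-1)^{q-k}\,\widehat t^{(A)}(q-k+1)-\widetilde t^{(A)}(q-k+1)\Big)=0 . \end{aligned}$$ -/

import Mathlib

open Filter Topology

noncomputable section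

namespace EulerSums

/-- The value of the infinite series `∑_{k=1}^∞ f k`, understood as the limit of its partial sums
(some of the series below converge only conditionally). -/
def series (f : ℕ → ℂ) : ℂ :=
  limUnder atTop (fun K : ℕ => ∑ k ∈ Finset.Icc 1 K, f k)

/-- `a_k = o(|k|^α)` as `k → ±∞`, for a two-sided sequence of complex numbers
(on `ℤ`, the cofinite filter is the filter `k → ±∞`). -/
def Growth (a : ℤ → ℂ) (α : ℝ) : Prop :=
  a =o[cofinite] (fun k : ℤ => |(k : ℝ)| ^ α)

/-- `D^{(A)}(j) = ∑_{k ≥ 1} a_k / k^j` for `j > 1`, with the convention `D^{(A)}(1) = 0`. -/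
def D (a : ℤ → ℂ) (j : ℕ) : ℂ :=
  if j = 1 then 0 else series fun k => a k / (k : ℂ) ^ j

/-- `t̂^{(A)}(j)`. -/
def tHat (a : ℤ → ℂ) (j : ℕ) : ℂ :=
  if j = 1 then series fun k => a (k - 1) / ((k : ℂ) - 1 / 2) - a k / (k : ℂ)
  else series fun k => a (k - 1) / ((k : ℂ) - 1 / 2) ^ j

/-- `t̃^{(A)}(j)`. -/
def tTilde (a : ℤ → ℂ) (j : ℕ) : ℂ :=
  if j = 1 then series fun k => a k / ((k : ℂ) - 1 / 2) - a k / (k : ℂ)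
  else series fun k => a k / ((k : ℂ) - 1 / 2) ^ j

/-- `Ê^{(A)}_n(j) = ∑_{k=1}^n a_{n-k} / (k-1/2)^j`. -/
def EHat (a : ℤ → ℂ) (n j : ℕ) : ℂ :=
  ∑ k ∈ Finset.Icc 1 n, a ((n : ℤ) - k) / ((k : ℂ) - 1 / 2) ^ j

/-- `Ẽ^{(A)}_n(j) = ∑_{k=1}^n a_{k-n-1} / (k-1/2)^j`. -/
def ETilde (a : ℤ → ℂ) (n j : ℕ) : ℂ :=
  ∑ k ∈ Finset.Icc 1 n, a ((k : ℤ) - n - 1) / ((k : ℂ) - 1 / 2) ^ j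

/-- `F̂^{(A)}_n(j)`. -/
def FHat (a : ℤ → ℂ) (n j : ℕ) : ℂ :=
  if j = 1 then series fun k => a ((k : ℤ) + n) / ((k : ℂ) - 1 / 2) - a k / (k : ℂ)
  else series fun k => a ((k : ℤ) + n) / ((k : ℂ) - 1 / 2) ^ j

/-- `F̃^{(A)}_n(j)`. -/
def FTilde (a : ℤ → ℂ) (n j : ℕ) : ℂ :=
  if j = 1 then series fun k => a ((k : ℤ) - n) / ((k : ℂ) - 1 / 2) - a k / (k : ℂ)
  else series fun k => a ((k : ℤ) - n) / ((k : ℂ) - 1 / 2) ^ j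

/-- `N^{(A)}_n(j) = Ê^{(A)}_n(j) + (-1)^j F̂^{(A)}_{n-1}(j)`, for `n ≥ 1`. -/
def N (a : ℤ → ℂ) (n j : ℕ) : ℂ :=
  EHat a n j + (-1) ^ j * FHat a (n - 1) j

/-- `N̄^{(A)}_n(j) = F̃^{(A)}_n(j) - Ẽ^{(A)}_{n-1}(j)`, for `n ≥ 1`. -/
def NBar (a : ℤ → ℂ) (n j : ℕ) : ℂ :=
  FTilde a n j - ETilde a (n - 1) j

/-- `S^{(A)}_n(j) = N^{(A)}_n(j) + N̄^{(A)}_n(j) - a_0 / (n-1/2)^j`, for `n ≥ 1`. -/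
def S (a : ℤ → ℂ) (n j : ℕ) : ℂ :=
  N a n j + NBar a n j - a 0 / ((n : ℂ) - 1 / 2) ^ j

end EulerSums

end

/-!
The identity is the partial fraction decomposition of `1 / ((x - m) ^ p * x ^ q)`, multiplied by
`a |i| * b m` and summed over all half-integers `x = i - 1/2`, `i ∈ ℤ`, and all integers `m ≥ 1`.

Writing `G j z = b 0 / z ^ j + ∑_{m ≥ 1} b m * (1 / (z - m) ^ j + [j = 1] / m)` (`poleSeries`), one
has `N_n(j) = G j (n - 1/2)` and `N̄_n(j) = (-1) ^ j * G j (1/2 - n)`; so the first two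
series together are `∑_{i ∈ ℤ} a |i| * G p x / x ^ q`, a double series over `(i, m)` plus the
contribution of `b 0`. Likewise `S_{m+1}(j)` and `t̃(j) + (-1) ^ j * t̂(j)` are the sums over `i ∈ ℤ`
of `a |i| / (m - x) ^ j` and `a |i| / x ^ j`, that is, of the other terms of the decomposition; the
remaining sum over `m` against powers of `m` gives the third series and the values of `D`.

The difficulty is conditional convergence for exponent `1`. It disappears by pairing: `1/(x - m)` is
only used with the correction `1/m` when it is summed over `m`, and only with `1/x` when it is
summed over `i`, where both terms have the same coefficient. The paired terms are
`x / (m (x - m))` and `m / (x (m - x))`, and higher powers of `1/(x - m)` are dominated by both.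
All double series thus converge absolutely by the single estimate `summable_kernel`: the sum of
`|x|⁻ˢ m⁻ᵗ |x - m|⁻¹` is finite if `s, t > 0` and `s + t > 1`. The decomposition itself is
`regKernel_mul_inv_pow_eq`, and the summed version is `tsum_regKernel_eq`.
-/

namespace EulerSums

/-! ### Half-integers and the basic double series -/

/-- The half-integer `i - 1/2`, as a complex number. -/
noncomputable def half (i : ℤ) : ℂ := (i : ℂ) - 1 / 2

theorem norm_half (i : ℤ) : ‖half i‖ = |(i : ℝ) + (-1 / 2)| := by
  rw [← Real.norm_eq_abs, ← Complex.norm_real]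
  congr 1
  simp only [half]
  push_cast
  ring

theorem one_half_le_norm_half (i : ℤ) : 1 / 2 ≤ ‖half i‖ := by
  rw [norm_half]
  rcases le_or_gt i 0 with h | h
  · have h' : (i : ℝ) ≤ 0 := by exact_mod_cast h
    rw [abs_of_nonpos (by linarith)]
    linarith
  · have h' : (1 : ℝ) ≤ i := by exact_mod_cast h
    rw [abs_of_nonneg (by linarith)]
    linarith

theorem norm_half_pos (i : ℤ) : 0 < ‖half i‖ :=
  lt_of_lt_of_le (by norm_num) (one_half_le_norm_half i)

theorem half_ne_zero (i : ℤ) : half i ≠ 0 := norm_pos_iff.mp (norm_half_pos i)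

theorem half_sub_natCast (i : ℤ) (m : ℕ) : half i - m = half (i - m) := by
  simp only [half]
  push_cast
  ring

theorem summable_norm_half_rpow {r : ℝ} (hr : 1 < r) :
    Summable fun i : ℤ => ‖half i‖ ^ (-r) := by
  refine ((Real.summable_one_div_int_add_rpow (-1 / 2) r).mpr hr).congr fun i => ?_
  rw [norm_half, Real.rpow_neg (abs_nonneg _), one_div]

theorem summable_pnat_rpow {r : ℝ} (hr : 1 < r) :
    Summable fun m : ℕ+ => (m : ℝ) ^ (-r) :=
  (Real.summable_nat_rpow.mpr (by linarith : -r < -1)).comp_injective PNat.coe_injective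

/-- If `x ≤ y` the first summand dominates, otherwise the second. -/
theorem rpow_neg_mul_rpow_neg_le {x y a b : ℝ} (hx : 0 < x) (hy : 0 < y) (ha : 0 ≤ a)
    (hb : 0 ≤ b) : x ^ (-a) * y ^ (-b) ≤ x ^ (-(a + b)) + y ^ (-(a + b)) := by
  have hxp := Real.rpow_pos_of_pos hx (-(a + b))
  have hyp := Real.rpow_pos_of_pos hy (-(a + b))
  rcases le_total x y with h | h
  · have h1 : y ^ (-b) ≤ x ^ (-b) := Real.rpow_le_rpow_of_nonpos hx h (by linarith)
    have h2 : x ^ (-a) * y ^ (-b) ≤ x ^ (-a) * x ^ (-b) := by gcongr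
    rw [← Real.rpow_add hx, ← neg_add] at h2
    linarith
  · have h1 : x ^ (-a) ≤ y ^ (-a) := Real.rpow_le_rpow_of_nonpos hy h (by linarith)
    have h2 : x ^ (-a) * y ^ (-b) ≤ y ^ (-a) * y ^ (-b) := by gcongr
    rw [← Real.rpow_add hy, ← neg_add] at h2
    linarith

/-- The absolute convergence estimate behind all double series below. A small power of
`|x - m| ≤ |x| + m` is given away to make the exponent of `|x - m|` exceed `1`; the remaining factor
is then at most a sum of a power of `|x|` and a power of `m`, each with exponent below `-1`. -/
theorem summable_kernel {s t : ℝ} (hs : 0 < s) (ht : 0 < t) (hst : 1 < s + t) :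
    Summable fun x : ℤ × ℕ+ =>
      ‖half x.1‖ ^ (-s) * (x.2 : ℝ) ^ (-t) * ‖half x.1 - x.2‖⁻¹ := by
  obtain ⟨ε, hε, hεs, hεt, hεst⟩ : ∃ ε : ℝ, 0 < ε ∧ ε ≤ s ∧ ε ≤ t ∧ 1 < s + t - 2 * ε := by
    refine ⟨min (min s t) ((s + t - 1) / 4), lt_min (lt_min hs ht) (by linarith), ?_, ?_, ?_⟩
    · exact (min_le_left _ _).trans (min_le_left _ _)
    · exact (min_le_left _ _).trans (min_le_right _ _)
    · have := min_le_right (min s t) ((s + t - 1) / 4)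
      linarith
  set r := s + t - 2 * ε with hr
  have hY : Summable fun i : ℤ => ‖half i‖ ^ (-(1 + ε)) :=
    summable_norm_half_rpow (by linarith)
  have h1 : Summable fun x : ℤ × ℕ+ =>
      ‖half x.1‖ ^ (-r) * ‖half (x.1 - x.2)‖ ^ (-(1 + ε)) := by
    have h := (summable_norm_half_rpow hεst).mul_of_nonneg hY
      (fun i => by positivity) (fun i => by positivity)
    refine h.comp_injective (i := fun x : ℤ × ℕ+ => (x.1, x.1 - (x.2 : ℤ))) ?_
    rintro ⟨i, m⟩ ⟨i', m'⟩ h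
    simp only [Prod.mk.injEq] at h
    obtain ⟨rfl, h⟩ := h
    ext
    · rfl
    · simpa using h
  have h2 : Summable fun x : ℤ × ℕ+ =>
      (x.2 : ℝ) ^ (-r) * ‖half (x.1 - x.2)‖ ^ (-(1 + ε)) := by
    have h := (summable_pnat_rpow hεst).mul_of_nonneg hY
      (fun i => by positivity) (fun i => by positivity)
    refine h.comp_injective (i := fun x : ℤ × ℕ+ => (x.2, x.1 - (x.2 : ℤ))) ?_
    rintro ⟨i, m⟩ ⟨i', m'⟩ h
    simp only [Prod.mk.injEq] at h
    obtain ⟨rfl, h⟩ := h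
    ext
    · simpa using h
    · rfl
  refine Summable.of_nonneg_of_le (fun x => by positivity) (fun x => ?_)
    ((h1.add h2).mul_left ((3 : ℝ) ^ ε))
  obtain ⟨i, m⟩ := x
  simp only
  have hm : (1 : ℝ) ≤ (m : ℕ) := by exact_mod_cast m.pos
  rw [half_sub_natCast]
  have hXY : ‖half (i - (m : ℕ))‖ ≤ ‖half i‖ + (m : ℕ) := by
    rw [← half_sub_natCast]
    simpa using norm_sub_le (half i) ((m : ℕ) : ℂ)
  have hX := one_half_le_norm_half i
  have hYp := norm_half_pos (i - (m : ℕ))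
  generalize ‖half (i - (m : ℕ))‖ = Y at *
  generalize ‖half i‖ = X at *
  generalize ((m : ℕ) : ℝ) = M at *
  have hXp : 0 < X := by linarith
  have hMp : 0 < M := by linarith
  have hY3 : Y ≤ 3 * (X * M) := by nlinarith
  have hYε : Y ^ ε ≤ 3 ^ ε * (X ^ ε * M ^ ε) := by
    rw [← Real.mul_rpow hXp.le hMp.le, ← Real.mul_rpow (by norm_num) (by positivity)]
    exact Real.rpow_le_rpow hYp.le hY3 hε.le
  have hinv : Y⁻¹ = Y ^ (-(1 + ε)) * Y ^ ε := by
    rw [← Real.rpow_add hYp, ← Real.rpow_neg_one]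
    congr 1
    ring
  calc X ^ (-s) * M ^ (-t) * Y⁻¹
      ≤ X ^ (-s) * M ^ (-t) * (Y ^ (-(1 + ε)) * (3 ^ ε * (X ^ ε * M ^ ε))) := by
        rw [hinv]
        gcongr
    _ = 3 ^ ε * ((X ^ (-s) * X ^ ε) * (M ^ (-t) * M ^ ε) * Y ^ (-(1 + ε))) := by ring
    _ = 3 ^ ε * (X ^ (-(s - ε)) * M ^ (-(t - ε)) * Y ^ (-(1 + ε))) := by
        rw [← Real.rpow_add hXp, ← Real.rpow_add hMp]
        congr 6 <;> ring
    _ ≤ 3 ^ ε * ((X ^ (-r) + M ^ (-r)) * Y ^ (-(1 + ε))) := by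
        have h := rpow_neg_mul_rpow_neg_le hXp hMp (a := s - ε) (b := t - ε)
          (by linarith) (by linarith)
        rw [show s - ε + (t - ε) = r by rw [hr]; ring] at h
        gcongr
    _ = _ := by ring

/-! ### Partial fractions -/

/-- With `X = 1/x`, `Y = 1/y`, `M = 1/(x + y)` this is the partial fraction decomposition of
`1 / (y ^ (P + 1) * x ^ (Q + 1))`; all that is used of these reciprocals is the relation `h`. -/
theorem partial_fractions {R : Type*} [CommRing R] {X Y M : R} (h : X * Y = M * (X + Y))
    (P Q : ℕ) :
    Y ^ (P + 1) * X ^ (Q + 1) =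
      ∑ i ∈ Finset.range (P + 1), ((Q + i).choose Q : R) * M ^ (Q + 1 + i) * Y ^ (P + 1 - i) +
      ∑ i ∈ Finset.range (Q + 1), ((P + i).choose P : R) * M ^ (P + 1 + i) * X ^ (Q + 1 - i) := by
  -- Pascal's rule, for either of the two sums.
  have key : ∀ (Z : R) (P Q : ℕ),
      ∑ i ∈ Finset.range (P + 2),
        ((Q + 1 + i).choose (Q + 1) : R) * M ^ (Q + 2 + i) * Z ^ (P + 2 - i) =
      M * (∑ i ∈ Finset.range (P + 1),
        ((Q + 1 + i).choose (Q + 1) : R) * M ^ (Q + 2 + i) * Z ^ (P + 1 - i) +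
        ∑ i ∈ Finset.range (P + 2),
        ((Q + i).choose Q : R) * M ^ (Q + 1 + i) * Z ^ (P + 2 - i)) := by
    intro Z P Q
    rw [Finset.sum_range_succ' _ (P + 1), Finset.sum_range_succ' _ (P + 1), mul_add, mul_add,
      ← add_assoc, Finset.mul_sum, Finset.mul_sum, ← Finset.sum_add_distrib]
    congr 1
    · refine Finset.sum_congr rfl fun i _ => ?_
      rw [show Q + 1 + (i + 1) = (Q + 1 + i) + 1 by ring, Nat.choose_succ_succ,
        show Q + (i + 1) = Q + 1 + i by ring, show P + 2 - (i + 1) = P + 1 - i by omega]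
      push_cast
      ring
    · simp
      ring
  have base : ∀ (Z W : R) (P : ℕ), Z * W = M * (Z + W) → Z ^ (P + 1) * W =
      ∑ i ∈ Finset.range (P + 1), M ^ (1 + i) * Z ^ (P + 1 - i) + M ^ (P + 1) * W := by
    intro Z W P hZW
    induction P with
    | zero =>
      simp
      linear_combination hZW
    | succ P ih =>
      have e : ∑ i ∈ Finset.range (P + 1), M ^ (1 + i) * Z ^ (P + 1 + 1 - i) =
          Z * ∑ i ∈ Finset.range (P + 1), M ^ (1 + i) * Z ^ (P + 1 - i) := by
        rw [Finset.mul_sum]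
        refine Finset.sum_congr rfl fun i hi => ?_
        rw [show P + 1 + 1 - i = (P + 1 - i) + 1 by have := Finset.mem_range.mp hi; omega]
        ring
      rw [Finset.sum_range_succ _ (P + 1), e, Nat.add_sub_cancel_left]
      linear_combination Z * ih + M ^ (P + 1) * hZW
  induction P generalizing Q with
  | zero =>
    have := base X Y Q h
    simp
    linear_combination this
  | succ P ihP =>
    induction Q with
    | zero =>
      have := base Y X (P + 1) (by linear_combination h)
      simp
      linear_combination this
    | succ Q ihQ =>
      have e : Y ^ (P + 1 + 1) * X ^ (Q + 1 + 1) =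
          M * (Y ^ (P + 1) * X ^ (Q + 1 + 1) + Y ^ (P + 1 + 1) * X ^ (Q + 1)) := by
        linear_combination Y ^ (P + 1) * X ^ (Q + 1) * h
      rw [e, ihQ, ihP, key Y P Q, key X Q P]
      ring

/-! ### Explicit growth bounds -/

/-- A growth bound survives as an explicit inequality when the exponent is increased. -/
theorem Growth.exists_bound {a : ℤ → ℂ} {α α' : ℝ} (ha : Growth a α) (h : α ≤ α') :
    ∃ C : ℝ, 0 ≤ C ∧ ∀ k : ℤ, k ≠ 0 → ‖a k‖ ≤ C * |(k : ℝ)| ^ α' := by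
  obtain ⟨C, hC, hb⟩ := Asymptotics.bound_of_isBigO_cofinite ha.isBigO
  refine ⟨C, hC.le, fun k hk => ?_⟩
  have h1 : (1 : ℝ) ≤ |(k : ℝ)| := by exact_mod_cast Int.one_le_abs hk
  have h0 : 0 < |(k : ℝ)| ^ α := Real.rpow_pos_of_pos (by linarith) _
  calc ‖a k‖ ≤ C * ‖|(k : ℝ)| ^ α‖ := hb h0.ne'
    _ = C * |(k : ℝ)| ^ α := by rw [Real.norm_of_nonneg h0.le]
    _ ≤ _ := by gcongr

theorem Growth.exists_bound_pnat {a : ℤ → ℂ} {α α' : ℝ} (ha : Growth a α) (h : α ≤ α') :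
    ∃ C : ℝ, 0 ≤ C ∧ ∀ m : ℕ+, ‖a m‖ ≤ C * (m : ℝ) ^ α' := by
  obtain ⟨C, hC, hb⟩ := ha.exists_bound h
  refine ⟨C, hC, fun m => ?_⟩
  simpa using hb m (by simp)

/-- The even extension `i ↦ a |i|` is dominated by a power of the half-integer `i - 1/2`. -/
theorem Growth.exists_bound_abs {a : ℤ → ℂ} {α α' : ℝ} (ha : Growth a α) (h : α ≤ α')
    (hα' : 0 ≤ α') :
    ∃ C : ℝ, 0 ≤ C ∧ ∀ i : ℤ, ‖a |i|‖ ≤ C * ‖half i‖ ^ α' := by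
  obtain ⟨C, hC, hb⟩ := ha.exists_bound h
  have h2 : (0 : ℝ) < 2 ^ α' := by positivity
  refine ⟨C * 2 ^ α' + ‖a 0‖ * 2 ^ α', by positivity, fun i => ?_⟩
  have hpos := norm_half_pos i
  have h3 : (0 : ℝ) ≤ ‖half i‖ ^ α' := by positivity
  rcases eq_or_ne i 0 with rfl | hi
  · have : (1 : ℝ) ≤ 2 ^ α' * ‖half 0‖ ^ α' := by
      rw [← Real.mul_rpow (by norm_num) hpos.le]
      exact Real.one_le_rpow (by have := one_half_le_norm_half 0; linarith) hα'
    rw [abs_zero]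
    nlinarith [norm_nonneg (a 0), mul_nonneg hC (mul_nonneg h2.le h3),
      mul_le_mul_of_nonneg_left this (norm_nonneg (a 0))]
  · have h4 : |(i : ℝ)| ≤ 2 * ‖half i‖ := by
      have h5 : (i : ℂ) = half i + 1 / 2 := by simp [half]
      have h6 := norm_add_le (half i) (1 / 2)
      rw [← h5, Complex.norm_intCast] at h6
      have := one_half_le_norm_half i
      norm_num at h6
      linarith
    have h7 := hb |i| (by simpa using hi)
    rw [Int.cast_abs, abs_abs] at h7
    calc ‖a |i|‖ ≤ C * |(i : ℝ)| ^ α' := h7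
      _ ≤ C * (2 * ‖half i‖) ^ α' := by gcongr
      _ = C * 2 ^ α' * ‖half i‖ ^ α' := by rw [Real.mul_rpow (by norm_num) hpos.le, mul_assoc]
      _ ≤ _ := by rw [add_mul]; exact le_add_of_nonneg_right (by positivity)

/-! ### The quantities `N`, `N̄`, `t̂`, `t̃` as values of one function -/

/-- The kernel `1 / (z - m) ^ j`, corrected by `1 / m` when `j = 1` so that summation over `m`
against a sequence bounded by `m ^ α`, `α < 1`, converges absolutely. -/
noncomputable def regKernel (j : ℕ) (z : ℂ) (m : ℕ+) : ℂ :=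
  ((z - m) ^ j)⁻¹ + if j = 1 then (m : ℂ)⁻¹ else 0

/-- The function of `z` with principal parts `a m / (z - m) ^ j` at the natural numbers `m ≥ 0`;
the term at `m = 0` needs no correction and is split off. -/
noncomputable def poleSeries (a : ℤ → ℂ) (j : ℕ) (z : ℂ) : ℂ :=
  a 0 * (z ^ j)⁻¹ + ∑' m : ℕ+, a m * regKernel j z m

theorem pow_inv_add_two (Y : ℝ) (k : ℕ) (hY : 1 / 2 ≤ Y) :
    (Y ^ (k + 2))⁻¹ ≤ 2 ^ k * (Y⁻¹ * Y⁻¹) := by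
  have h : Y⁻¹ ≤ 2 := by
    rw [inv_le_comm₀ (by linarith) (by norm_num)]
    linarith
  have h0 : 0 ≤ Y⁻¹ := by rw [inv_nonneg]; linarith
  rw [← inv_pow, pow_add, pow_two]
  gcongr

/-- At half-integers, every power `(x - m)⁻ᵏ` with `k ≥ 2` is dominated by `|x| / (m |x - m|)`
as well as by `m / (|x| |x - m|)`. -/
theorem norm_half_sub_pow_inv_le (i : ℤ) (m : ℕ+) (k : ℕ) :
    ‖((half i - m) ^ (k + 2))⁻¹‖ ≤ 4 * 2 ^ k * (‖half i‖ * (m : ℝ)⁻¹ * ‖half i - m‖⁻¹) ∧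
    ‖((half i - m) ^ (k + 2))⁻¹‖ ≤ 4 * 2 ^ k * (‖half i‖⁻¹ * (m : ℝ) * ‖half i - m‖⁻¹) := by
  have hm : (1 : ℝ) ≤ (m : ℕ) := by exact_mod_cast m.pos
  have hM : ((m : ℕ) : ℝ) ≤ ‖half i‖ + ‖half i - m‖ := by
    have h := norm_sub_le (half i) (half i - (m : ℕ))
    simpa using h
  have hX' : ‖half i‖ ≤ ‖half i - m‖ + (m : ℕ) := by
    have h := norm_add_le (half i - (m : ℕ)) (m : ℕ)
    simpa using h
  have hY : 1 / 2 ≤ ‖half i - m‖ := by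
    rw [half_sub_natCast]
    exact one_half_le_norm_half _
  have hX := one_half_le_norm_half i
  rw [norm_inv, norm_pow]
  have h := pow_inv_add_two _ k hY
  generalize ‖half i - m‖ = Y at *
  generalize ‖half i‖ = X at *
  generalize ((m : ℕ) : ℝ) = M at *
  have hXp : 0 < X := by linarith
  have hYp : 0 < Y := by linarith
  have hMp : 0 < M := by linarith
  have h1 : Y⁻¹ ≤ 4 * (X * M⁻¹) := by
    rw [inv_le_iff_one_le_mul₀ hYp, mul_comm X, ← mul_assoc, mul_comm 4, mul_assoc, mul_assoc,
      inv_mul_eq_div, le_div_iff₀ hMp]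
    nlinarith
  have h2 : Y⁻¹ ≤ 4 * (X⁻¹ * M) := by
    rw [inv_le_iff_one_le_mul₀ hYp, ← mul_assoc, mul_comm 4, mul_assoc, mul_assoc,
      inv_mul_eq_div, le_div_iff₀ hXp]
    nlinarith
  constructor
  · calc _ ≤ _ := h
      _ ≤ 2 ^ k * (4 * (X * M⁻¹) * Y⁻¹) := by gcongr
      _ = _ := by ring
  · calc _ ≤ _ := h
      _ ≤ 2 ^ k * (4 * (X⁻¹ * M) * Y⁻¹) := by gcongr
      _ = _ := by ring

theorem half_sub_pnat_ne_zero (i : ℤ) (m : ℕ+) : half i - m ≠ 0 := by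
  rw [half_sub_natCast]
  exact half_ne_zero _

theorem norm_regKernel_le (i : ℤ) (m : ℕ+) (P : ℕ) :
    ‖regKernel (P + 1) (half i) m‖ ≤
      4 * 2 ^ P * (‖half i‖ * (m : ℝ)⁻¹ * ‖half i - m‖⁻¹) := by
  have hm : ((m : ℕ) : ℂ) ≠ 0 := by simp
  have hne := half_sub_pnat_ne_zero i m
  cases P with
  | zero =>
    -- The correction turns the kernel into exactly `x / (m (x - m))`.
    have e : regKernel (0 + 1) (half i) m = half i * (m : ℂ)⁻¹ * (half i - m)⁻¹ := by
      simp only [regKernel, zero_add, if_true, pow_one]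
      field_simp
      ring
    rw [e, norm_mul, norm_mul, norm_inv, norm_inv, Complex.norm_natCast]
    have : 0 ≤ ‖half i‖ * (m : ℝ)⁻¹ * ‖half i - m‖⁻¹ := by positivity
    linarith
  | succ k =>
    have e : regKernel (k + 1 + 1) (half i) m = ((half i - m) ^ (k + 2))⁻¹ := by
      simp [regKernel]
    rw [e]
    refine (norm_half_sub_pow_inv_le i m k).1.trans ?_
    gcongr <;> norm_num

section PoleSeries

variable {b : ℤ → ℂ} {β C : ℝ}

/-- The exponent `2` of `|x|` in the kernel estimate is irrelevant here, as `x` is fixed. -/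
theorem summable_mul_regKernel (hβ : β < 1) (hb : ∀ m : ℕ+, ‖b m‖ ≤ C * (m : ℝ) ^ β) (P : ℕ)
    (i : ℤ) : Summable fun m : ℕ+ => b m * regKernel (P + 1) (half i) m := by
  have h := (summable_kernel (s := 2) (t := 1 - β) (by norm_num) (by linarith)
    (by linarith)).comp_injective (i := fun m : ℕ+ => (i, m)) (Prod.mk_right_injective i)
  have hC : 0 ≤ C := by simpa using (norm_nonneg _).trans (hb 1)
  refine Summable.of_norm_bounded
    (h.mul_left (C * (4 * 2 ^ P) * (‖half i‖ * ‖half i‖ ^ (2 : ℝ)))) fun m => ?_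
  have hm : (0 : ℝ) < (m : ℕ) := by exact_mod_cast m.pos
  have hX := norm_half_pos i
  rw [norm_mul]
  calc _ ≤ (C * (m : ℝ) ^ β) * (4 * 2 ^ P * (‖half i‖ * (m : ℝ)⁻¹ * ‖half i - m‖⁻¹)) :=
        mul_le_mul (hb m) (norm_regKernel_le i m P) (norm_nonneg _) (by positivity)
    _ = C * (4 * 2 ^ P) * ‖half i‖ * (((m : ℝ) ^ β * (m : ℝ)⁻¹) * ‖half i - m‖⁻¹) := by ring
    _ = C * (4 * 2 ^ P) * ‖half i‖ * (‖half i‖ ^ (2 : ℝ) * ‖half i‖ ^ (-2 : ℝ)) *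
        ((m : ℝ) ^ (-(1 - β)) * ‖half i - m‖⁻¹) := by
        rw [← Real.rpow_neg_one (m : ℝ), ← Real.rpow_add hm, ← Real.rpow_add hX]
        simp only [add_neg_cancel, Real.rpow_zero, mul_one]
        congr 4
        ring
    _ = _ := by
        simp only [Function.comp]
        ring

theorem tendsto_div_natCast (hβ : β < 1) (hb : ∀ m : ℕ+, ‖b m‖ ≤ C * (m : ℝ) ^ β) :
    Tendsto (fun m : ℕ => b m / (m : ℂ)) atTop (𝓝 0) := by
  have h : Tendsto (fun m : ℕ => C * (m : ℝ) ^ (-(1 - β))) atTop (𝓝 0) := by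
    simpa using ((tendsto_rpow_neg_atTop (by linarith : 0 < 1 - β)).comp
      tendsto_natCast_atTop_atTop).const_mul C
  refine squeeze_zero_norm' ?_ h
  filter_upwards [eventually_gt_atTop 0] with m hm
  have hm' : (0 : ℝ) < m := by exact_mod_cast hm
  rw [norm_div, Complex.norm_natCast, div_le_iff₀ hm', mul_assoc, ← Real.rpow_add_one hm'.ne']
  simpa using hb ⟨m, hm⟩

theorem tendsto_sum_range_add_sub {u : ℕ → ℂ} (hu : Tendsto u atTop (𝓝 0)) (r s : ℕ) :
    Tendsto (fun K => ∑ m ∈ Finset.range (K + r), u m - ∑ m ∈ Finset.range (K + s), u m)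
      atTop (𝓝 0) := by
  have key : ∀ r : ℕ, Tendsto (fun K => ∑ x ∈ Finset.range r, u (K + x)) atTop (𝓝 0) := by
    intro r
    have := tendsto_finsetSum (Finset.range r)
      fun i _ => hu.comp (tendsto_add_atTop_nat i)
    simpa using this
  have := (key r).sub (key s)
  simpa [Finset.sum_range_add] using this

/-- The partial sums of the pole part and of the correcting terms may be cut off at different
places, since single correcting terms tend to zero. -/
theorem tendsto_poleSeries (hβ : β < 1) (hb : ∀ m : ℕ+, ‖b m‖ ≤ C * (m : ℝ) ^ β) (P : ℕ)
    (i : ℤ) (r s : ℕ) :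
    Tendsto (fun K : ℕ => ∑ m ∈ Finset.range (K + r), b m * ((half i - m) ^ (P + 1))⁻¹ +
      ∑ m ∈ Finset.range (K + s), if P + 1 = 1 then b m / (m : ℂ) else 0)
      atTop (𝓝 (poleSeries b (P + 1) (half i))) := by
  -- At `m = 0` the correcting term is `b 0 / 0 = 0`.
  set f : ℕ → ℂ := fun m => b m * ((half i - m) ^ (P + 1))⁻¹ +
    if P + 1 = 1 then b m / (m : ℂ) else 0 with hf
  have hfm : ∀ m : ℕ+, f m = b m * regKernel (P + 1) (half i) m := by
    intro m
    simp only [hf, regKernel, mul_add, mul_ite, mul_zero, div_eq_mul_inv]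
  have hsum : Summable f := by
    rw [← summable_nat_add_iff 1, ← summable_pnat_iff_summable_succ]
    exact (summable_mul_regKernel hβ hb P i).congr fun m => (hfm m).symm
  have hG : ∑' m, f m = poleSeries b (P + 1) (half i) := by
    rw [hsum.tsum_eq_zero_add, ← tsum_pnat_eq_tsum_succ, tsum_congr hfm, poleSeries]
    simp [hf]
  have h1 := (hsum.hasSum.tendsto_sum_nat.comp (tendsto_add_atTop_nat r))
  rw [hG] at h1
  have hu : Tendsto (fun m : ℕ => if P + 1 = 1 then b m / (m : ℂ) else 0) atTop (𝓝 0) := by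
    split_ifs
    · exact tendsto_div_natCast hβ hb
    · exact tendsto_const_nhds
  have h2 := h1.add (tendsto_sum_range_add_sub hu s r)
  rw [add_zero] at h2
  refine h2.congr fun K => ?_
  simp only [Function.comp, hf, Finset.sum_add_distrib]
  ring

theorem sum_Icc_one (f : ℕ → ℂ) (K : ℕ) :
    ∑ k ∈ Finset.Icc 1 K, f k = ∑ k ∈ Finset.range K, f (k + 1) := by
  rw [Finset.range_eq_Ico, Finset.sum_Ico_add' f 0 K 1]
  rfl

theorem series_eq_of_tendsto {f : ℕ → ℂ} {L : ℂ}
    (h : Tendsto (fun K => ∑ k ∈ Finset.range K, f (k + 1)) atTop (𝓝 L)) : series f = L := by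
  simp only [series, sum_Icc_one]
  exact h.limUnder_eq

theorem sum_range_succ_correction (j K : ℕ) :
    ∑ m ∈ Finset.range (K + 1), (if j = 1 then b m / (m : ℂ) else 0) =
      ∑ k ∈ Finset.range K, if j = 1 then b ((k + 1 : ℕ) : ℤ) / ((k + 1 : ℕ) : ℂ) else 0 := by
  rw [Finset.sum_range_succ']
  simp

/-- The finite sum `Ê` supplies the terms with `m < x` and `F̂` those with `m > x`. -/
theorem N_eq_poleSeries (hβ : β < 1) (hb : ∀ m : ℕ+, ‖b m‖ ≤ C * (m : ℝ) ^ β) (P n : ℕ) :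
    N b (n + 1) (P + 1) = poleSeries b (P + 1) (half (n + 1)) := by
  have hF : FHat b n (P + 1) = series fun k => b ((k : ℤ) + n) / ((k : ℂ) - 1 / 2) ^ (P + 1) -
      if P + 1 = 1 then b k / (k : ℂ) else 0 := by
    simp only [FHat]
    split_ifs with h
    · simp [h]
    · simp
  have hE : EHat b (n + 1) (P + 1) =
      ∑ m ∈ Finset.range (n + 1), b m * ((half (n + 1) - m) ^ (P + 1))⁻¹ := by
    rw [EHat, sum_Icc_one, ← Finset.sum_range_reflect]
    refine Finset.sum_congr rfl fun k hk => ?_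
    have hk' : k ≤ n := by have := Finset.mem_range.mp hk; omega
    rw [div_eq_mul_inv, show n + 1 - 1 - k = n - k by omega]
    congr 2
    · push_cast [hk']
      ring
    · simp only [half]
      push_cast [hk']
      ring
  have hs : (-1 : ℂ) ^ (P + 1) * (-1) ^ (P + 1) = 1 := by
    rw [← mul_pow]
    simp
  have key : FHat b n (P + 1) = (-1) ^ (P + 1) * (poleSeries b (P + 1) (half (n + 1)) -
      EHat b (n + 1) (P + 1)) := by
    rw [hF]
    apply series_eq_of_tendsto
    have h := ((tendsto_poleSeries hβ hb P (n + 1) (n + 1) 1).sub_const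
      (EHat b (n + 1) (P + 1))).const_mul ((-1 : ℂ) ^ (P + 1))
    refine h.congr fun K => ?_
    rw [hE, add_comm K (n + 1), Finset.sum_range_add, sum_range_succ_correction,
      Finset.sum_sub_distrib, add_assoc, add_sub_cancel_left, mul_add, sub_eq_add_neg,
      Finset.mul_sum]
    congr 1
    · refine Finset.sum_congr rfl fun k _ => ?_
      rw [div_eq_mul_inv, mul_left_comm, ← inv_pow, ← inv_pow, ← mul_pow]
      congr 2
      · push_cast
        ring
      · rw [neg_one_mul, ← inv_neg]
        congr 1
        simp only [half]
        push_cast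
        ring
    · by_cases hP : P = 0
      · simp [hP]
      · simp [hP]
  rw [N, Nat.add_sub_cancel, key, ← mul_assoc, hs]
  ring

/-- The terms of `F̃` with negative index are cancelled by `Ẽ`, so only `b m` with `m ≥ 0`
enters. -/
theorem NBar_eq_poleSeries (hβ : β < 1) (hb : ∀ m : ℕ+, ‖b m‖ ≤ C * (m : ℝ) ^ β) (P n : ℕ) :
    NBar b (n + 1) (P + 1) = (-1) ^ (P + 1) * poleSeries b (P + 1) (half (-n)) := by
  have hF : FTilde b (n + 1) (P + 1) = series fun k =>
      b ((k : ℤ) - (n + 1 : ℕ)) / ((k : ℂ) - 1 / 2) ^ (P + 1) -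
      if P + 1 = 1 then b k / (k : ℂ) else 0 := by
    simp only [FTilde]
    split_ifs with h
    · simp [h]
    · simp
  have key : FTilde b (n + 1) (P + 1) = ETilde b n (P + 1) +
      (-1) ^ (P + 1) * poleSeries b (P + 1) (half (-n)) := by
    rw [hF]
    apply series_eq_of_tendsto
    have h := ((tendsto_poleSeries hβ hb P (-n) 0 (n + 1)).const_mul
      ((-1 : ℂ) ^ (P + 1))).const_add (ETilde b n (P + 1))
    rw [← tendsto_add_atTop_iff_nat n]
    refine h.congr fun K => ?_
    rw [← add_assoc K n 1, sum_range_succ_correction, Finset.sum_sub_distrib, mul_add,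
      sub_eq_add_neg, ← add_assoc]
    congr 1
    · rw [add_zero, add_comm K n, Finset.sum_range_add, ETilde, sum_Icc_one, Finset.mul_sum]
      congr 1
      · refine Finset.sum_congr rfl fun k _ => ?_
        congr 2
        push_cast
        ring
      · refine Finset.sum_congr rfl fun k _ => ?_
        rw [div_eq_mul_inv, mul_left_comm, ← inv_pow, ← inv_pow, ← mul_pow]
        congr 2
        · push_cast
          ring
        · rw [neg_one_mul, ← inv_neg]
          congr 1
          simp only [half]
          push_cast
          ring
    · by_cases hP : P = 0
      · simp [hP]
      · simp [hP]
  rw [NBar, Nat.add_sub_cancel, key]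
  ring

theorem tHat_eq_NBar (a : ℤ → ℂ) (j : ℕ) : tHat a j = NBar a 1 j := by
  simp [tHat, NBar, FTilde, ETilde]

theorem tTilde_eq_N (a : ℤ → ℂ) (P : ℕ) :
    N a 1 (P + 1) = a 0 * (half 1 ^ (P + 1))⁻¹ + (-1) ^ (P + 1) * tTilde a (P + 1) := by
  simp [tTilde, N, FHat, EHat, half, div_eq_mul_inv]

end PoleSeries

/-! ### Series over the integers -/

theorem summable_int_pnat {f : ℤ → ℂ} (hf : Summable f) : Summable fun m : ℕ+ => f m :=
  hf.comp_injective fun m n h => by simpa using h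

theorem summable_int_neg_pnat {f : ℤ → ℂ} (hf : Summable f) :
    Summable fun m : ℕ+ => f (-(m : ℤ)) :=
  hf.comp_injective fun m n h => by simpa using h

theorem summable_int_one_sub_pnat {f : ℤ → ℂ} (hf : Summable f) :
    Summable fun m : ℕ+ => f (1 - (m : ℤ)) :=
  hf.comp_injective fun m n h => by simpa using h

theorem tsum_int_eq_zero_add {f : ℤ → ℂ} (hf : Summable f) :
    ∑' i, f i = f 0 + ∑' m : ℕ+, (f m + f (-(m : ℤ))) := by
  have h1 := summable_int_pnat hf
  have h2 := summable_int_neg_pnat hf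
  rw [h1.tsum_add h2]
  have e1 := tsum_pnat_eq_tsum_succ (f := fun m : ℕ => f m)
  have e2 := tsum_pnat_eq_tsum_succ (f := fun m : ℕ => f (-(m : ℤ)))
  have s1 := (summable_pnat_iff_summable_succ
      (f := fun m : ℕ => f m)).mp h1
  have s2 := (summable_pnat_iff_summable_succ
      (f := fun m : ℕ => f (-(m : ℤ)))).mp h2
  push_cast at e1 e2 s1 s2
  rw [tsum_of_add_one_of_neg_add_one s1 s2, e1, e2]
  ring

theorem tsum_int_eq_add_one_sub {f : ℤ → ℂ} (hf : Summable f) :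
    ∑' i, f i = ∑' n : ℕ+, f n + ∑' n : ℕ+, f (1 - (n : ℤ)) := by
  have h1 := summable_int_pnat hf
  have h2 := summable_int_one_sub_pnat hf
  have e1 := tsum_pnat_eq_tsum_succ (f := fun m : ℕ => f m)
  have e2 := tsum_pnat_eq_tsum_succ (f := fun m : ℕ => f (1 - (m : ℤ)))
  have s1 := (summable_pnat_iff_summable_succ
      (f := fun m : ℕ => f m)).mp h1
  have s2 := (summable_pnat_iff_summable_succ
      (f := fun m : ℕ => f (1 - (m : ℤ)))).mp h2
  push_cast at e1 e2 s1 s2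
  have e (n : ℕ) : (1 : ℤ) - (n + 1) = -(n + 1) + 1 := by ring
  simp only [e] at e2 s2
  rw [e1, e2, ← (Equiv.addRight (1 : ℤ)).tsum_eq f]
  exact tsum_of_nat_of_neg_add_one (f := fun i => f (i + 1)) s1 s2

/-! ### Inner sums over the half-integers -/

/-- The combination of `t̃` and `t̂` that is the (symmetrically summed) series
`∑ a |i| / (i - 1/2) ^ j` over all integers `i`. -/
noncomputable def tSum (a : ℤ → ℂ) (j : ℕ) : ℂ := tTilde a j + (-1) ^ j * tHat a j

theorem neg_one_pow_mul_inv_pow (z : ℂ) (j : ℕ) : (-1) ^ j * (z ^ j)⁻¹ = ((-z) ^ j)⁻¹ := by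
  rw [← inv_pow, ← inv_pow, ← mul_pow, neg_one_mul, inv_neg]

theorem neg_one_pow_mul_self (j : ℕ) : (-1 : ℂ) ^ j * (-1) ^ j = 1 := by
  rw [← mul_pow]
  simp

section Evaluation

variable {a : ℤ → ℂ} {α C : ℝ}

theorem tSum_eq (hα : α < 1) (ha : ∀ m : ℕ+, ‖a m‖ ≤ C * (m : ℝ) ^ α) (J : ℕ) :
    tSum a (J + 1) = a 0 * (half 0 ^ (J + 1))⁻¹ +
      ∑' m : ℕ+, a m * (regKernel (J + 1) (half 0) m +
        (-1) ^ (J + 1) * regKernel (J + 1) (half 1) m) := by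
  have h1 := N_eq_poleSeries hα ha J 0
  have h2 := NBar_eq_poleSeries hα ha J 0
  have h3 := tTilde_eq_N a J
  simp only [zero_add, Nat.cast_zero, neg_zero, poleSeries] at h1 h2
  have hs := neg_one_pow_mul_self (J + 1)
  have e : ∀ m : ℕ+, a m * (regKernel (J + 1) (half 0) m +
        (-1) ^ (J + 1) * regKernel (J + 1) (half 1) m) =
      a m * regKernel (J + 1) (half 0) m +
        (-1) ^ (J + 1) * (a m * regKernel (J + 1) (half 1) m) := fun m => by ring
  rw [tsum_congr e, (summable_mul_regKernel hα ha J 0).tsum_add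
    ((summable_mul_regKernel hα ha J 1).mul_left _), tsum_mul_left, tSum, tHat_eq_NBar, h2]
  rw [h1] at h3
  linear_combination (-(-1) ^ (J + 1)) * h3 + (a 0 * (half 0 ^ (J + 1))⁻¹ +
    ∑' m : ℕ+, a m * regKernel (J + 1) (half 0) m - tTilde a (J + 1)) * hs

theorem S_eq (hα : α < 1) (ha : ∀ m : ℕ+, ‖a m‖ ≤ C * (m : ℝ) ^ α) (J n : ℕ) :
    S a (n + 1) (J + 1) = a 0 * (half (n + 1) ^ (J + 1))⁻¹ +
      ∑' m : ℕ+, a m * (regKernel (J + 1) (half (n + 1)) m +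
        (-1) ^ (J + 1) * regKernel (J + 1) (half (-n)) m) := by
  have e : ∀ m : ℕ+, a m * (regKernel (J + 1) (half (n + 1)) m +
        (-1) ^ (J + 1) * regKernel (J + 1) (half (-n)) m) =
      a m * regKernel (J + 1) (half (n + 1)) m +
        (-1) ^ (J + 1) * (a m * regKernel (J + 1) (half (-n)) m) := fun m => by ring
  have h0 : a 0 / (((n + 1 : ℕ) : ℂ) - 1 / 2) ^ (J + 1) =
      (-1) ^ (J + 1) * (a 0 * (half (-n) ^ (J + 1))⁻¹) := by
    rw [mul_left_comm, neg_one_pow_mul_inv_pow, div_eq_mul_inv]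
    congr 3
    simp only [half]
    push_cast
    ring
  rw [tsum_congr e, (summable_mul_regKernel hα ha J _).tsum_add
    ((summable_mul_regKernel hα ha J _).mul_left _), tsum_mul_left, S, h0,
    N_eq_poleSeries hα ha, NBar_eq_poleSeries hα ha, poleSeries, poleSeries]
  ring

theorem tsum_inv_half_pow_eq (hα : α < 1) (ha : ∀ m : ℕ+, ‖a m‖ ≤ C * (m : ℝ) ^ α) (J : ℕ)
    (h : Summable fun i : ℤ => a |i| * (half i ^ (J + 2))⁻¹) :
    ∑' i : ℤ, a |i| * (half i ^ (J + 2))⁻¹ = tSum a (J + 2) := by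
  rw [tsum_int_eq_zero_add h, tSum_eq hα ha (J + 1), abs_zero]
  congr 1
  refine tsum_congr fun m => ?_
  have e1 : half 0 - (m : ℕ) = half (-(m : ℕ)) := by simp [half]; ring
  have e2 : -(half 1 - (m : ℕ)) = half (m : ℕ) := by simp [half]; ring
  simp only [regKernel, Nat.add_eq_right, Nat.add_eq_zero_iff, one_ne_zero, and_false, if_false,
    add_zero, neg_one_pow_mul_inv_pow, e1, e2, abs_neg, Nat.abs_cast]
  ring

theorem tsum_inv_natCast_sub_half_pow_eq (hα : α < 1)
    (ha : ∀ m : ℕ+, ‖a m‖ ≤ C * (m : ℝ) ^ α) (J n : ℕ)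
    (h : Summable fun i : ℤ => a |i| * ((n - half i) ^ (J + 2))⁻¹) :
    ∑' i : ℤ, a |i| * ((n - half i) ^ (J + 2))⁻¹ = S a (n + 1) (J + 2) := by
  rw [tsum_int_eq_zero_add h, S_eq hα ha (J + 1), abs_zero]
  have e0 : n - half 0 = half (n + 1) := by simp [half]; ring
  rw [e0]
  congr 1
  refine tsum_congr fun m => ?_
  have e1 : half (n + 1) - (m : ℕ) = n - half (m : ℕ) := by simp [half]; ring
  have e2 : -(half (-n) - (m : ℕ)) = n - half (-(m : ℕ)) := by simp [half]; ring
  simp only [regKernel, Nat.add_eq_right, Nat.add_eq_zero_iff, one_ne_zero, and_false, if_false,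
    add_zero, neg_one_pow_mul_inv_pow, e1, e2, abs_neg, Nat.abs_cast]
  ring

/-- The conditionally convergent parts of `S` and `t̃ - t̂` combine to an absolutely convergent
series. -/
theorem tsum_inv_natCast_sub_half_add_inv_eq (hα : α < 1)
    (ha : ∀ m : ℕ+, ‖a m‖ ≤ C * (m : ℝ) ^ α) (n : ℕ)
    (h : Summable fun i : ℤ => a |i| * ((n - half i)⁻¹ + (half i)⁻¹)) :
    ∑' i : ℤ, a |i| * ((n - half i)⁻¹ + (half i)⁻¹) = S a (n + 1) 1 + tSum a 1 := by
  have hS := S_eq hα ha 0 n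
  have hT := tSum_eq hα ha 0
  have s := fun i => summable_mul_regKernel hα ha 0 i
  have s1 : Summable fun m : ℕ+ => a m * (regKernel (0 + 1) (half (n + 1)) m +
      (-1) ^ (0 + 1) * regKernel (0 + 1) (half (-n)) m) :=
    ((s (n + 1)).add ((s (-n)).mul_left ((-1) ^ (0 + 1)))).congr fun m => by ring
  have s2 : Summable fun m : ℕ+ => a m * (regKernel (0 + 1) (half 0) m +
      (-1) ^ (0 + 1) * regKernel (0 + 1) (half 1) m) :=
    ((s 0).add ((s 1).mul_left ((-1) ^ (0 + 1)))).congr fun m => by ring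
  rw [zero_add] at hS hT s1 s2
  have e0 : n - half 0 = half (n + 1) := by simp [half]; ring
  rw [tsum_int_eq_zero_add h, hS, hT, abs_zero, e0, add_add_add_comm, ← s1.tsum_add s2]
  congr 1
  · ring
  refine tsum_congr fun m => ?_
  have e1 : half (n + 1) - (m : ℕ) = n - half (m : ℕ) := by simp [half]; ring
  have e2 : half (-n) - (m : ℕ) = -(n - half (-(m : ℕ))) := by simp [half]; ring
  have e3 : half 0 - (m : ℕ) = half (-(m : ℕ)) := by simp [half]; ring
  have e4 : half 1 - (m : ℕ) = -half (m : ℕ) := by simp [half]; ring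
  simp only [regKernel, if_true, pow_one, e1, e2, e3, e4, abs_neg, Nat.abs_cast, inv_neg]
  ring

end Evaluation

/-! ### The Dirichlet series `D` and the decomposed kernel -/

/-- The coefficient of `b m` in `D b j`; the value `0` at `j = 1` encodes the convention
`D b 1 = 0`. -/
noncomputable def dCoeff (j : ℕ) (m : ℕ+) : ℂ := if j = 1 then 0 else ((m : ℂ) ^ j)⁻¹

theorem summable_mul_dCoeff {b : ℤ → ℂ} {β C : ℝ} (hβ : β < 1)
    (hb : ∀ m : ℕ+, ‖b m‖ ≤ C * (m : ℝ) ^ β) (j : ℕ) :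
    Summable fun m : ℕ+ => b m * dCoeff (j + 1) m := by
  cases j with
  | zero => simp [dCoeff]
  | succ j =>
    refine Summable.of_norm_bounded
      ((summable_pnat_rpow (by linarith : 1 < 2 - β)).mul_left C) fun m => ?_
    have hm : (1 : ℝ) ≤ (m : ℕ) := by exact_mod_cast m.pos
    have hm0 : (0 : ℝ) < (m : ℕ) := by linarith
    have hC : 0 ≤ C := by simpa using (norm_nonneg _).trans (hb 1)
    simp only [dCoeff, Nat.add_eq_right, Nat.add_eq_zero_iff, one_ne_zero, and_false, if_false,
      norm_mul, norm_inv, norm_pow, Complex.norm_natCast]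
    calc ‖b m‖ * ((m : ℝ) ^ (j + 1 + 1))⁻¹ ≤ C * (m : ℝ) ^ β * ((m : ℝ) ^ 2)⁻¹ := by
          gcongr
          · exact hb m
          · omega
      _ = C * (m : ℝ) ^ (-(2 - β)) := by
          rw [mul_assoc, ← Real.rpow_natCast, ← Real.rpow_neg hm0.le, ← Real.rpow_add hm0]
          congr 2
          push_cast
          ring

theorem D_eq_tsum {b : ℤ → ℂ} {β C : ℝ} (hβ : β < 1)
    (hb : ∀ m : ℕ+, ‖b m‖ ≤ C * (m : ℝ) ^ β) (j : ℕ) :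
    D b (j + 1) = ∑' m : ℕ+, b m * dCoeff (j + 1) m := by
  cases j with
  | zero => simp [D, dCoeff]
  | succ j =>
    have h := summable_mul_dCoeff hβ hb (j + 1)
    simp only [D, dCoeff, Nat.add_eq_right, Nat.add_eq_zero_iff, one_ne_zero, and_false,
      if_false] at h ⊢
    apply series_eq_of_tendsto
    have s := (summable_pnat_iff_summable_succ
      (f := fun m : ℕ => b m * ((m : ℂ) ^ (j + 1 + 1))⁻¹)).mp h
    have e := tsum_pnat_eq_tsum_succ (f := fun m : ℕ => b m * ((m : ℂ) ^ (j + 1 + 1))⁻¹)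
    rw [e]
    exact s.hasSum.tendsto_sum_nat

/-- Partial fractions at `x = i - 1/2`. The terms `1/(m - x)` and `1/x`, whose sums over `i`
converge only conditionally, have equal coefficients and are paired. For `P = 0` the correcting term
`1/m` of `regKernel` accounts for the summand that `dCoeff 1 = 0` suppresses. -/
theorem regKernel_mul_inv_pow_eq (P Q : ℕ) (hQ : 1 ≤ Q) (i : ℤ) (m : ℕ+) :
    regKernel (P + 1) (half i) m * (half i ^ (Q + 1))⁻¹ = (-1) ^ (P + 1) *
      ((P + Q).choose Q * (((m : ℂ) ^ (P + Q + 1))⁻¹ * ((m - half i)⁻¹ + (half i)⁻¹)) +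
        ∑ k ∈ Finset.range P, ((P + Q - k - 1).choose Q : ℂ) *
          (((m : ℂ) ^ (P + Q - k))⁻¹ * ((m - half i) ^ (k + 2))⁻¹) +
        ∑ k ∈ Finset.range Q, ((k + P).choose P : ℂ) *
          (dCoeff (k + P + 1) m * (half i ^ (Q + 1 - k))⁻¹)) := by
  have hm : ((m : ℕ) : ℂ) ≠ 0 := by simp
  have hx := half_ne_zero i
  have hy : (m : ℂ) - half i ≠ 0 := by
    rw [← neg_sub, neg_ne_zero]
    exact half_sub_pnat_ne_zero i m
  have hXY : (half i)⁻¹ * ((m : ℂ) - half i)⁻¹ =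
      (m : ℂ)⁻¹ * ((half i)⁻¹ + ((m : ℂ) - half i)⁻¹) := by
    field_simp
    ring
  have h := partial_fractions hXY P Q
  have h1 : ∑ k ∈ Finset.range (P + 1), ((Q + k).choose Q : ℂ) * (m : ℂ)⁻¹ ^ (Q + 1 + k) *
        ((m : ℂ) - half i)⁻¹ ^ (P + 1 - k) =
      (P + Q).choose Q * ((m : ℂ)⁻¹ ^ (P + Q + 1) * ((m : ℂ) - half i)⁻¹) +
        ∑ k ∈ Finset.range P, ((P + Q - k - 1).choose Q : ℂ) *
          ((m : ℂ)⁻¹ ^ (P + Q - k) * ((m : ℂ) - half i)⁻¹ ^ (k + 2)) := by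
    rw [← Finset.sum_range_reflect, Finset.sum_range_succ', add_comm]
    congr 1
    · simp only [Nat.add_sub_cancel, Nat.sub_zero, Nat.add_sub_cancel_left, pow_one]
      rw [show Q + 1 + P = P + Q + 1 by ring, add_comm Q P]
      ring
    · refine Finset.sum_congr rfl fun k hk => ?_
      have := Finset.mem_range.mp hk
      rw [show P + 1 - 1 - (k + 1) = P - (k + 1) by omega,
        show Q + (P - (k + 1)) = P + Q - k - 1 by omega,
        show Q + 1 + (P - (k + 1)) = P + Q - k by omega,
        show P + 1 - (P - (k + 1)) = k + 2 by omega]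
      ring
  have h2 : ∑ k ∈ Finset.range (Q + 1), ((P + k).choose P : ℂ) * (m : ℂ)⁻¹ ^ (P + 1 + k) *
        (half i)⁻¹ ^ (Q + 1 - k) =
      (P + Q).choose Q * ((m : ℂ)⁻¹ ^ (P + Q + 1) * (half i)⁻¹) +
        ∑ k ∈ Finset.range Q, ((k + P).choose P : ℂ) *
          (dCoeff (k + P + 1) m * (half i)⁻¹ ^ (Q + 1 - k)) +
        (if P + 1 = 1 then (m : ℂ)⁻¹ else 0) * (half i)⁻¹ ^ (Q + 1) := by
    rw [Finset.sum_range_succ, add_comm, Nat.choose_symm_add,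
      Nat.add_sub_cancel_left, pow_one, show P + 1 + Q = P + Q + 1 by ring, mul_assoc,
      add_assoc (G := ℂ)]
    congr 1
    by_cases hP : P = 0
    · subst hP
      obtain ⟨Q, rfl⟩ : ∃ Q' : ℕ, Q = Q' + 1 := ⟨Q - 1, by omega⟩
      rw [Finset.sum_range_succ', Finset.sum_range_succ' _ Q]
      simp only [dCoeff]
      simp
      refine Finset.sum_congr rfl fun k _ => ?_
      rw [show 1 + (k + 1) = k + 1 + 1 by ring]
    · simp only [dCoeff, Nat.add_eq_right, Nat.add_eq_zero_iff, hP, and_false, if_false,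
        zero_mul, add_zero]
      refine Finset.sum_congr rfl fun k _ => ?_
      rw [add_comm P k, show P + 1 + k = k + P + 1 by ring, inv_pow (m : ℂ), mul_assoc]
  rw [h1, h2] at h
  simp only [← inv_pow] at h ⊢
  have hreg : regKernel (P + 1) (half i) m = (-1) ^ (P + 1) * ((m : ℂ) - half i)⁻¹ ^ (P + 1) +
      if P + 1 = 1 then (m : ℂ)⁻¹ else 0 := by
    rw [regKernel, inv_pow, neg_one_pow_mul_inv_pow, neg_sub]
  -- The correcting term is present only for `P = 0`, where `(-1) ^ (P + 1) = -1`.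
  have hsgn : (if P + 1 = 1 then (m : ℂ)⁻¹ else 0) =
      -((-1) ^ (P + 1) * if P + 1 = 1 then (m : ℂ)⁻¹ else 0) := by
    by_cases hP : P = 0
    · simp [hP]
    · simp [hP]
  rw [hreg]
  linear_combination (-1) ^ (P + 1) * h + (half i)⁻¹ ^ (Q + 1) * hsgn

/-! ### Absolute convergence of the double series -/

section DoubleSeries

variable {c : ℤ → ℂ} {b : ℤ → ℂ} {α β A B : ℝ}

theorem summable_mul_regKernel_mul_inv_pow (hβ : β < 1) (hc : ∀ i, ‖c i‖ ≤ A * ‖half i‖ ^ α)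
    (hb : ∀ m : ℕ+, ‖b m‖ ≤ B * (m : ℝ) ^ β) (P Q : ℕ) (hα : α < Q) (hαβ : α + β < Q) :
    Summable fun x : ℤ × ℕ+ => c x.1 * b x.2 *
      (regKernel (P + 1) (half x.1) x.2 * (half x.1 ^ (Q + 1))⁻¹) := by
  have h := summable_kernel (s := Q - α) (t := 1 - β) (by linarith) (by linarith) (by linarith)
  have hA : 0 ≤ A := by
    have h1 := (norm_nonneg _).trans (hc 0)
    exact nonneg_of_mul_nonneg_left h1 (Real.rpow_pos_of_pos (norm_half_pos 0) _)
  have hB : 0 ≤ B := by simpa using (norm_nonneg _).trans (hb 1)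
  refine Summable.of_norm_bounded (h.mul_left (A * B * (4 * 2 ^ P))) ?_
  rintro ⟨i, m⟩
  have hm : (0 : ℝ) < (m : ℕ) := by exact_mod_cast m.pos
  have hX := norm_half_pos i
  simp only [norm_mul, norm_inv, norm_pow]
  have hX' : ‖half i‖ ^ (-(Q - α)) = ‖half i‖ ^ α * ‖half i‖ * (‖half i‖ ^ (Q + 1))⁻¹ := by
    rw [← Real.rpow_natCast, ← Real.rpow_neg hX.le, ← Real.rpow_add_one hX.ne',
      ← Real.rpow_add hX]
    congr 1
    push_cast
    ring
  have hm' : (m : ℝ) ^ (-(1 - β)) = (m : ℝ) ^ β * (m : ℝ)⁻¹ := by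
    rw [← Real.rpow_neg_one (m : ℝ), ← Real.rpow_add hm]
    congr 1
    ring
  calc _ ≤ (A * ‖half i‖ ^ α) * (B * (m : ℝ) ^ β) *
        (4 * 2 ^ P * (‖half i‖ * (m : ℝ)⁻¹ * ‖half i - m‖⁻¹) * (‖half i‖ ^ (Q + 1))⁻¹) := by
        gcongr
        · exact hc i
        · exact hb m
        · exact norm_regKernel_le i m P
    _ = _ := by
        rw [hX', hm']
        ring

theorem summable_mul_inv_pow_mul (hα : α < 1) (hc : ∀ i, ‖c i‖ ≤ A * ‖half i‖ ^ α)
    (hb : ∀ m : ℕ+, ‖b m‖ ≤ B * (m : ℝ) ^ β) (Q E : ℕ) (hβ : β < Q) (hαβ : α + β < Q)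
    (hE : Q + 1 ≤ E) {F : ℤ → ℕ+ → ℂ} {T : ℝ}
    (hF : ∀ i m, ‖F i m‖ ≤ T * (‖half i‖⁻¹ * (m : ℝ) * ‖half i - m‖⁻¹)) :
    Summable fun x : ℤ × ℕ+ => c x.1 * b x.2 * (((x.2 : ℂ) ^ E)⁻¹ * F x.1 x.2) := by
  have h := summable_kernel (s := 1 - α) (t := Q - β) (by linarith) (by linarith) (by linarith)
  have hA : 0 ≤ A := by
    have h1 := (norm_nonneg _).trans (hc 0)
    exact nonneg_of_mul_nonneg_left h1 (Real.rpow_pos_of_pos (norm_half_pos 0) _)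
  have hB : 0 ≤ B := by simpa using (norm_nonneg _).trans (hb 1)
  refine Summable.of_norm_bounded (h.mul_left (A * B * T)) ?_
  rintro ⟨i, m⟩
  have hm1 : (1 : ℝ) ≤ (m : ℕ) := by exact_mod_cast m.pos
  have hm : (0 : ℝ) < (m : ℕ) := by linarith
  have hX := norm_half_pos i
  simp only [norm_mul, norm_inv, norm_pow, Complex.norm_natCast]
  have hX' : ‖half i‖ ^ (-(1 - α)) = ‖half i‖ ^ α * ‖half i‖⁻¹ := by
    rw [← Real.rpow_neg_one ‖half i‖, ← Real.rpow_add hX]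
    congr 1
    ring
  have hm' : (m : ℝ) ^ (-(Q - β)) = (m : ℝ) ^ β * ((m : ℝ) ^ (Q + 1))⁻¹ * (m : ℝ) := by
    rw [← Real.rpow_natCast, ← Real.rpow_neg hm.le, ← Real.rpow_add hm, ← Real.rpow_add_one hm.ne']
    congr 1
    push_cast
    ring
  calc _ ≤ (A * ‖half i‖ ^ α) * (B * (m : ℝ) ^ β) * (((m : ℝ) ^ (Q + 1))⁻¹ *
        (T * (‖half i‖⁻¹ * (m : ℝ) * ‖half i - m‖⁻¹))) := by
        gcongr
        · exact hc i
        · exact hb m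
        · exact hF i m
    _ = _ := by
        rw [hX', hm']
        ring

theorem norm_inv_sub_half_add_inv_half (i : ℤ) (m : ℕ+) :
    ‖(m - half i)⁻¹ + (half i)⁻¹‖ ≤ 1 * (‖half i‖⁻¹ * (m : ℝ) * ‖half i - m‖⁻¹) := by
  have hx := half_ne_zero i
  have hy : (m : ℂ) - half i ≠ 0 := by
    rw [← neg_sub, neg_ne_zero]
    exact half_sub_pnat_ne_zero i m
  have e : (m - half i)⁻¹ + (half i)⁻¹ = (half i)⁻¹ * m * (m - half i)⁻¹ := by
    field_simp
    ring
  rw [e, norm_mul, norm_mul, norm_inv, norm_inv, Complex.norm_natCast, norm_sub_rev, one_mul]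

theorem norm_inv_sub_half_pow (i : ℤ) (m : ℕ+) (k : ℕ) :
    ‖((m - half i) ^ (k + 2))⁻¹‖ ≤
      4 * 2 ^ k * (‖half i‖⁻¹ * (m : ℝ) * ‖half i - m‖⁻¹) := by
  rw [norm_inv, norm_pow, norm_sub_rev (m : ℂ) (half i), ← norm_pow, ← norm_inv]
  exact (norm_half_sub_pow_inv_le i m k).2

theorem summable_mul_inv_half_pow (hα : α < 1) (hc : ∀ i, ‖c i‖ ≤ A * ‖half i‖ ^ α) (J : ℕ) :
    Summable fun i : ℤ => c i * (half i ^ (J + 2))⁻¹ := by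
  have hA : 0 ≤ A := by
    have h1 := (norm_nonneg _).trans (hc 0)
    exact nonneg_of_mul_nonneg_left h1 (Real.rpow_pos_of_pos (norm_half_pos 0) _)
  refine Summable.of_norm_bounded ((summable_norm_half_rpow
    (by linarith : 1 < 2 - α)).mul_left (A * 2 ^ J)) fun i => ?_
  have hX := norm_half_pos i
  have h := pow_inv_add_two _ J (one_half_le_norm_half i)
  rw [norm_mul, norm_inv, norm_pow]
  calc _ ≤ (A * ‖half i‖ ^ α) * (2 ^ J * (‖half i‖⁻¹ * ‖half i‖⁻¹)) :=
        mul_le_mul (hc i) h (by positivity) (by positivity)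
    _ = A * 2 ^ J * (‖half i‖ ^ α * ‖half i‖ ^ (-1 : ℝ) * ‖half i‖ ^ (-1 : ℝ)) := by
        rw [Real.rpow_neg_one]
        ring
    _ = _ := by
        rw [← Real.rpow_add hX, ← Real.rpow_add hX]
        congr 2
        ring

end DoubleSeries

/-! ### Summation of the decomposed kernel -/

section Summation

variable {a b : ℤ → ℂ} {α β A A' B : ℝ}

theorem summable_mul_S (hα : α < 1) (hα0 : 0 < α)
    (hc : ∀ i : ℤ, ‖a |i|‖ ≤ A * ‖half i‖ ^ α)
    (ha : ∀ m : ℕ+, ‖a m‖ ≤ A' * (m : ℝ) ^ α)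
    (hb : ∀ m : ℕ+, ‖b m‖ ≤ B * (m : ℝ) ^ β) (Q E k : ℕ) (hαβ : α + β < Q) (hE : Q + 1 ≤ E) :
    Summable (fun n : ℕ+ => b n * S a (n + 1) (k + 2) / (n : ℂ) ^ E) ∧
    ∑' x : ℤ × ℕ+, a |x.1| * b x.2 * (((x.2 : ℂ) ^ E)⁻¹ * ((x.2 - half x.1) ^ (k + 2))⁻¹) =
      ∑' n : ℕ+, b n * S a (n + 1) (k + 2) / (n : ℂ) ^ E := by
  have h := (summable_mul_inv_pow_mul hα hc hb Q E (by linarith) hαβ hE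
    (F := fun i m => ((m - half i) ^ (k + 2))⁻¹) fun i m => norm_inv_sub_half_pow i m k)
  have key : ∀ n : ℕ+, ∑' i : ℤ, a |i| * b n * (((n : ℂ) ^ E)⁻¹ * ((n - half i) ^ (k + 2))⁻¹) =
      b n * S a (n + 1) (k + 2) / (n : ℂ) ^ E := by
    intro n
    have hs := h.prod_symm.prod_factor n
    simp only [Prod.swap_prod_mk] at hs
    have e : ∀ i : ℤ, a |i| * b n * (((n : ℂ) ^ E)⁻¹ * ((n - half i) ^ (k + 2))⁻¹) =
        b n * ((n : ℂ) ^ E)⁻¹ * (a |i| * ((n - half i) ^ (k + 2))⁻¹) := fun i => by ring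
    rw [tsum_congr e, tsum_mul_left]
    -- Summability of the row is inherited from the double series only if `b n ≠ 0`.
    by_cases hb0 : b n = 0
    · simp [hb0]
    have hne : b n * ((n : ℂ) ^ E)⁻¹ ≠ 0 := mul_ne_zero hb0 (by simp)
    rw [tsum_inv_natCast_sub_half_pow_eq hα ha k n
      ((summable_mul_left_iff hne).mp (hs.congr e)), div_eq_mul_inv]
    ring
  constructor
  · exact h.prod_symm.prod.congr key
  · rw [← (Equiv.prodComm ℕ+ ℤ).tsum_eq]
    exact h.prod_symm.tsum_prod.trans (tsum_congr key)

/-- In the first power only the sum of `1/(m - x)` and `1/x` is absolutely summable over `x`; the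
two contributions are separated after summation over `x`. -/
theorem summable_mul_S_one (hα : α < 1) (hα0 : 0 < α) (hβ : β < 1)
    (hc : ∀ i : ℤ, ‖a |i|‖ ≤ A * ‖half i‖ ^ α)
    (ha : ∀ m : ℕ+, ‖a m‖ ≤ A' * (m : ℝ) ^ α)
    (hb : ∀ m : ℕ+, ‖b m‖ ≤ B * (m : ℝ) ^ β) (Q E : ℕ) (hQ : 1 ≤ Q) (hαβ : α + β < Q)
    (hE : Q + 1 ≤ E) :
    Summable (fun n : ℕ+ => b n * S a (n + 1) 1 / (n : ℂ) ^ E) ∧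
    ∑' x : ℤ × ℕ+, a |x.1| * b x.2 * (((x.2 : ℂ) ^ E)⁻¹ * ((x.2 - half x.1)⁻¹ + (half x.1)⁻¹)) =
      ∑' n : ℕ+, b n * S a (n + 1) 1 / (n : ℂ) ^ E + D b E * tSum a 1 := by
  have h := (summable_mul_inv_pow_mul hα hc hb Q E (by linarith) hαβ hE
    (F := fun i m => (m - half i)⁻¹ + (half i)⁻¹) norm_inv_sub_half_add_inv_half)
  obtain ⟨E, rfl⟩ : ∃ E' : ℕ, E = E' + 1 := ⟨E - 1, by omega⟩
  have hd := summable_mul_dCoeff hβ hb E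
  have hdc : ∀ n : ℕ+, dCoeff (E + 1) n = ((n : ℂ) ^ (E + 1))⁻¹ := fun n => by
    rw [dCoeff, if_neg (by omega)]
  have key : ∀ n : ℕ+, ∑' i : ℤ, a |i| * b n *
      (((n : ℂ) ^ (E + 1))⁻¹ * ((n - half i)⁻¹ + (half i)⁻¹)) =
      b n * S a (n + 1) 1 / (n : ℂ) ^ (E + 1) + b n * dCoeff (E + 1) n * tSum a 1 := by
    intro n
    have hs := h.prod_symm.prod_factor n
    simp only [Prod.swap_prod_mk] at hs
    have e : ∀ i : ℤ, a |i| * b n * (((n : ℂ) ^ (E + 1))⁻¹ * ((n - half i)⁻¹ + (half i)⁻¹)) =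
        b n * ((n : ℂ) ^ (E + 1))⁻¹ * (a |i| * ((n - half i)⁻¹ + (half i)⁻¹)) :=
      fun i => by ring
    rw [tsum_congr e, tsum_mul_left]
    -- Summability of the row is inherited from the double series only if `b n ≠ 0`.
    by_cases hb0 : b n = 0
    · simp [hb0]
    have hne : b n * ((n : ℂ) ^ (E + 1))⁻¹ ≠ 0 := mul_ne_zero hb0 (by simp)
    rw [tsum_inv_natCast_sub_half_add_inv_eq hα ha n
      ((summable_mul_left_iff hne).mp (hs.congr e)), div_eq_mul_inv, hdc]
    ring
  have hsum : Summable (fun n : ℕ+ => b n * S a (n + 1) 1 / (n : ℂ) ^ (E + 1)) :=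
    ((h.prod_symm.prod.congr key).sub (hd.mul_right (tSum a 1))).congr fun n => by ring
  refine ⟨hsum, ?_⟩
  rw [← (Equiv.prodComm ℕ+ ℤ).tsum_eq]
  refine h.prod_symm.tsum_prod.trans ((tsum_congr key).trans ?_)
  rw [hsum.tsum_add (hd.mul_right _), tsum_mul_right, D_eq_tsum hβ hb]

theorem tsum_dCoeff_mul_inv_half_pow (hα : α < 1) (hβ : β < 1)
    (hc : ∀ i : ℤ, ‖a |i|‖ ≤ A * ‖half i‖ ^ α)
    (ha : ∀ m : ℕ+, ‖a m‖ ≤ A' * (m : ℝ) ^ α)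
    (hb : ∀ m : ℕ+, ‖b m‖ ≤ B * (m : ℝ) ^ β) (j J : ℕ) :
    Summable (fun x : ℤ × ℕ+ => a |x.1| * b x.2 *
      (dCoeff (j + 1) x.2 * (half x.1 ^ (J + 2))⁻¹)) ∧
    ∑' x : ℤ × ℕ+, a |x.1| * b x.2 * (dCoeff (j + 1) x.2 * (half x.1 ^ (J + 2))⁻¹) =
      D b (j + 1) * tSum a (J + 2) := by
  have h1 := summable_mul_inv_half_pow (c := fun i => a |i|) hα hc J
  have h2 := summable_mul_dCoeff hβ hb j
  have e : ∀ x : ℤ × ℕ+, a |x.1| * (half x.1 ^ (J + 2))⁻¹ * (b x.2 * dCoeff (j + 1) x.2) =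
      a |x.1| * b x.2 * (dCoeff (j + 1) x.2 * (half x.1 ^ (J + 2))⁻¹) := fun x => by ring
  refine ⟨(summable_mul_of_summable_norm h1.norm h2.norm).congr e, ?_⟩
  rw [← tsum_congr e, ← tsum_mul_tsum_of_summable_norm h1.norm h2.norm,
    tsum_inv_half_pow_eq hα ha J h1, D_eq_tsum hβ hb, mul_comm]

/-- The partial fraction decomposition, summed term by term over all pairs `(i, m)`. The pairs are
summed over `i` first on the right-hand side. -/
theorem tsum_regKernel_eq (hα : α < 1) (hα0 : 0 < α) (hβ : β < 1)
    (hc : ∀ i : ℤ, ‖a |i|‖ ≤ A * ‖half i‖ ^ α)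
    (ha : ∀ m : ℕ+, ‖a m‖ ≤ A' * (m : ℝ) ^ α)
    (hb : ∀ m : ℕ+, ‖b m‖ ≤ B * (m : ℝ) ^ β) (P Q : ℕ) (hQ : 1 ≤ Q) (hαβ : α + β < Q) :
    ∑' x : ℤ × ℕ+, a |x.1| * b x.2 *
      (regKernel (P + 1) (half x.1) x.2 * (half x.1 ^ (Q + 1))⁻¹) =
    (-1) ^ (P + 1) *
      ((P + Q).choose Q * (∑' n : ℕ+, b n * S a (n + 1) 1 / (n : ℂ) ^ (P + Q + 1) +
          D b (P + Q + 1) * tSum a 1) +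
        ∑ k ∈ Finset.range P, ((P + Q - k - 1).choose Q : ℂ) *
          ∑' n : ℕ+, b n * S a (n + 1) (k + 2) / (n : ℂ) ^ (P + Q - k) +
        ∑ k ∈ Finset.range Q, ((k + P).choose P : ℂ) *
          (D b (k + P + 1) * tSum a (Q + 1 - k))) := by
  have s0 := summable_mul_inv_pow_mul (c := fun i => a |i|) hα hc hb Q (P + Q + 1) (by linarith)
    hαβ (by omega) (F := fun i m => (m - half i)⁻¹ + (half i)⁻¹) norm_inv_sub_half_add_inv_half
  have s1 : ∀ k ∈ Finset.range P, Summable fun x : ℤ × ℕ+ => a |x.1| * b x.2 *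
      (((x.2 : ℂ) ^ (P + Q - k))⁻¹ * ((x.2 - half x.1) ^ (k + 2))⁻¹) := fun k hk =>
    summable_mul_inv_pow_mul (c := fun i => a |i|) hα hc hb Q (P + Q - k) (by linarith) hαβ
      (by have := Finset.mem_range.mp hk; omega)
      (F := fun i m => ((m - half i) ^ (k + 2))⁻¹) fun i m => norm_inv_sub_half_pow i m k
  have s2 : ∀ k ∈ Finset.range Q, _ := fun k hk =>
    tsum_dCoeff_mul_inv_half_pow hα hβ hc ha hb (k + P) (Q - 1 - k)
  have hexp : ∀ k ∈ Finset.range Q, Q - 1 - k + 2 = Q + 1 - k := fun k hk => by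
    have := Finset.mem_range.mp hk
    omega
  have t0 := (summable_mul_S_one hα hα0 hβ hc ha hb Q (P + Q + 1) hQ hαβ (by omega)).2
  have e : ∀ x : ℤ × ℕ+, a |x.1| * b x.2 *
      (regKernel (P + 1) (half x.1) x.2 * (half x.1 ^ (Q + 1))⁻¹) =
      (-1) ^ (P + 1) * ((P + Q).choose Q * (a |x.1| * b x.2 *
          (((x.2 : ℂ) ^ (P + Q + 1))⁻¹ * ((x.2 - half x.1)⁻¹ + (half x.1)⁻¹))) +
        ∑ k ∈ Finset.range P, ((P + Q - k - 1).choose Q : ℂ) * (a |x.1| * b x.2 *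
          (((x.2 : ℂ) ^ (P + Q - k))⁻¹ * ((x.2 - half x.1) ^ (k + 2))⁻¹)) +
        ∑ k ∈ Finset.range Q, ((k + P).choose P : ℂ) * (a |x.1| * b x.2 *
          (dCoeff (k + P + 1) x.2 * (half x.1 ^ (Q - 1 - k + 2))⁻¹))) := by
    rintro ⟨i, m⟩
    have e1 : ∑ k ∈ Finset.range Q, ((k + P).choose P : ℂ) * (a |i| * b m *
          (dCoeff (k + P + 1) m * (half i ^ (Q - 1 - k + 2))⁻¹)) =
        a |i| * b m * ∑ k ∈ Finset.range Q, ((k + P).choose P : ℂ) *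
          (dCoeff (k + P + 1) m * (half i ^ (Q + 1 - k))⁻¹) := by
      rw [Finset.mul_sum]
      refine Finset.sum_congr rfl fun k hk => ?_
      rw [hexp k hk]
      ring
    have e2 : ∑ k ∈ Finset.range P, ((P + Q - k - 1).choose Q : ℂ) * (a |i| * b m *
          (((m : ℂ) ^ (P + Q - k))⁻¹ * ((m - half i) ^ (k + 2))⁻¹)) =
        a |i| * b m * ∑ k ∈ Finset.range P, ((P + Q - k - 1).choose Q : ℂ) *
          (((m : ℂ) ^ (P + Q - k))⁻¹ * ((m - half i) ^ (k + 2))⁻¹) := by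
      rw [Finset.mul_sum]
      exact Finset.sum_congr rfl fun k _ => by ring
    simp only
    rw [regKernel_mul_inv_pow_eq P Q hQ i m, e1, e2]
    ring
  have s1' := fun k hk => (s1 k hk).mul_left ((P + Q - k - 1).choose Q : ℂ)
  have s2' := fun k hk => (s2 k hk).1.mul_left ((k + P).choose P : ℂ)
  rw [tsum_congr e, tsum_mul_left,
    ((s0.mul_left _).add (summable_sum s1')).tsum_add (summable_sum s2'),
    (s0.mul_left _).tsum_add (summable_sum s1'), Summable.tsum_finsetSum s1',
    Summable.tsum_finsetSum s2', tsum_mul_left, t0]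
  congr 2
  · congr 1
    refine Finset.sum_congr rfl fun k hk => ?_
    rw [tsum_mul_left, (summable_mul_S hα hα0 hc ha hb Q (P + Q - k) k hαβ
      (by have := Finset.mem_range.mp hk; omega)).2]
  · refine Finset.sum_congr rfl fun k hk => ?_
    rw [tsum_mul_left, (s2 k hk).2, hexp k hk]

theorem summable_poleSeries_mul (hα : α < 1) (hβ : β < 1) (hβ0 : 0 < β)
    (hc : ∀ i : ℤ, ‖a |i|‖ ≤ A * ‖half i‖ ^ α)
    (ha : ∀ m : ℕ+, ‖a m‖ ≤ A' * (m : ℝ) ^ α)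
    (hb : ∀ m : ℕ+, ‖b m‖ ≤ B * (m : ℝ) ^ β) (P Q : ℕ) (hαβ : α + β < Q) :
    Summable (fun i : ℤ => poleSeries b (P + 1) (half i) * (half i ^ (Q + 1))⁻¹ * a |i|) ∧
    ∑' i : ℤ, poleSeries b (P + 1) (half i) * (half i ^ (Q + 1))⁻¹ * a |i| =
      ∑' x : ℤ × ℕ+, a |x.1| * b x.2 *
        (regKernel (P + 1) (half x.1) x.2 * (half x.1 ^ (Q + 1))⁻¹) +
      b 0 * tSum a (P + Q + 2) := by
  have h := summable_mul_regKernel_mul_inv_pow (c := fun i => a |i|) hβ hc hb P Q (by linarith) hαβ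
  have h0 := summable_mul_inv_half_pow (c := fun i => a |i|) hα hc (P + Q)
  have e : ∀ i : ℤ, ∑' m : ℕ+, a |i| * b m *
      (regKernel (P + 1) (half i) m * (half i ^ (Q + 1))⁻¹) +
      b 0 * (a |i| * (half i ^ (P + Q + 2))⁻¹) =
      poleSeries b (P + 1) (half i) * (half i ^ (Q + 1))⁻¹ * a |i| := by
    intro i
    have e1 : ∀ m : ℕ+, a |i| * b m * (regKernel (P + 1) (half i) m * (half i ^ (Q + 1))⁻¹) =
        a |i| * (half i ^ (Q + 1))⁻¹ * (b m * regKernel (P + 1) (half i) m) := fun m => by ring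
    rw [tsum_congr e1, tsum_mul_left, poleSeries,
      show P + Q + 2 = (P + 1) + (Q + 1) by ring, pow_add, mul_inv]
    ring
  have h1 := h.prod
  have h2 := h0.mul_left (b 0)
  refine ⟨(h1.add h2).congr e, ?_⟩
  rw [← tsum_congr e, h1.tsum_add h2, tsum_mul_left, tsum_inv_half_pow_eq hα ha _ h0, h.tsum_prod]

end Summation

/-- Growth exponents may be taken positive, which spares a case distinction on their signs: since
`1 ≤ r`, replacing a nonpositive exponent by a small positive one keeps `α + β < r`. -/
theorem exists_larger_exponents {α β r : ℝ} (hα : α < 1) (hβ : β < 1) (hr : 1 ≤ r)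
    (h : α + β < r) : ∃ α' β' : ℝ, α ≤ α' ∧ β ≤ β' ∧ 0 < α' ∧ 0 < β' ∧ α' < 1 ∧ β' < 1 ∧
      α' + β' < r := by
  obtain ⟨δ, h0, h1, h2, h3⟩ : ∃ δ : ℝ, 0 < δ ∧ δ ≤ 1 / 4 ∧ δ ≤ (1 - α) / 2 ∧ δ ≤ (1 - β) / 2 :=
    ⟨min (1 / 4) (min ((1 - α) / 2) ((1 - β) / 2)),
      lt_min (by norm_num) (lt_min (by linarith) (by linarith)), min_le_left _ _,
      (min_le_right _ _).trans (min_le_left _ _), (min_le_right _ _).trans (min_le_right _ _)⟩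
  refine ⟨max α δ, max β δ, le_max_left _ _, le_max_left _ _, lt_max_of_lt_right h0,
    lt_max_of_lt_right h0, max_lt hα (by linarith), max_lt hβ (by linarith), ?_⟩
  rcases max_cases α δ with ⟨e, _⟩ | ⟨e, _⟩ <;> rcases max_cases β δ with ⟨e', _⟩ | ⟨e', _⟩ <;>
    rw [e, e'] <;> linarith

end EulerSums

theorem theorem3p1 (a b : ℤ → ℂ) (α β : ℝ) (hα : α < 1) (hβ : β < 1)
    (ha : EulerSums.Growth a α) (hb : EulerSums.Growth b β)
    (p q : ℕ) (hp : 0 < p) (hq : 1 < q) (hαβ : α + β < (q : ℝ) - 1) :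
    Summable (fun n : ℕ+ =>
        EulerSums.NBar b n p / ((n : ℂ) - 1 / 2) ^ q * a ((n : ℤ) - 1)) ∧
    Summable (fun n : ℕ+ =>
        EulerSums.N b n p / ((n : ℂ) - 1 / 2) ^ q * a (n : ℤ)) ∧
    (∀ k ∈ Finset.range p, Summable (fun n : ℕ+ =>
        b (n : ℤ) * EulerSums.S a ((n : ℕ) + 1) (k + 1) / (n : ℂ) ^ (p + q - k - 1))) ∧
    (-1) ^ (p + q) *
        (∑' n : ℕ+, EulerSums.NBar b n p / ((n : ℂ) - 1 / 2) ^ q * a ((n : ℤ) - 1))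
      + (∑' n : ℕ+, EulerSums.N b n p / ((n : ℂ) - 1 / 2) ^ q * a (n : ℤ))
      - (-1) ^ p * (∑ k ∈ Finset.range p, (Nat.choose (p + q - k - 2) (q - 1) : ℂ) *
          ∑' n : ℕ+,
            b (n : ℤ) * EulerSums.S a ((n : ℕ) + 1) (k + 1) / (n : ℂ) ^ (p + q - k - 1))
      - b 0 * ((-1) ^ (p + q) * EulerSums.tHat a (p + q) + EulerSums.tTilde a (p + q))
      + (-1) ^ p * (∑ k ∈ Finset.Icc 1 q, (Nat.choose (k + p - 2) (p - 1) : ℂ) *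
          EulerSums.D b (k + p - 1) *
          ((-1) ^ (q - k) * EulerSums.tHat a (q - k + 1) - EulerSums.tTilde a (q - k + 1)))
      = 0 := by
  open EulerSums in
  obtain ⟨P, rfl⟩ : ∃ P : ℕ, p = P + 1 := ⟨p - 1, by omega⟩
  obtain ⟨Q, rfl⟩ : ∃ Q : ℕ, q = Q + 1 := ⟨q - 1, by omega⟩
  have hQ : 1 ≤ Q := by omega
  have hQ' : (1 : ℝ) ≤ Q := by exact_mod_cast hQ
  obtain ⟨α', β', hαα', hββ', hα0, hβ0, hα1, hβ1, hαβ'⟩ :=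
    exists_larger_exponents hα hβ hQ' (by push_cast at hαβ; linarith)
  obtain ⟨A, -, hA⟩ := ha.exists_bound_abs hαα' hα0.le
  obtain ⟨A', -, hA'⟩ := ha.exists_bound_pnat hαα'
  obtain ⟨B, -, hB⟩ := hb.exists_bound_pnat hββ'
  obtain ⟨hs, ht⟩ := summable_poleSeries_mul hα1 hβ1 hβ0 hA hA' hB P Q hαβ'
  rw [tsum_regKernel_eq hα1 hα0 hβ1 hA hA' hB P Q hQ hαβ', tsum_int_eq_add_one_sub hs] at ht
  -- The half-integers are split into `n - 1/2` and `1/2 - n` with `n ≥ 1`.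
  have eN : ∀ n : ℕ+, poleSeries b (P + 1) (half n) * (half n ^ (Q + 1))⁻¹ * a |((n : ℕ) : ℤ)| =
      N b n (P + 1) / ((n : ℂ) - 1 / 2) ^ (Q + 1) * a n := by
    intro n
    obtain ⟨n, rfl⟩ : ∃ k : ℕ, n = k.succPNat := ⟨n.natPred, by simp⟩
    have h := N_eq_poleSeries hβ1 hB P n
    simp only [Nat.succPNat_coe, Nat.succ_eq_add_one, Nat.abs_cast, div_eq_mul_inv, h]
    simp [half]
  have eNBar : ∀ n : ℕ+, (-1) ^ (P + 1 + (Q + 1)) * (poleSeries b (P + 1) (half (1 - n)) *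
      (half (1 - n) ^ (Q + 1))⁻¹ * a |1 - ((n : ℕ) : ℤ)|) =
      NBar b n (P + 1) / ((n : ℂ) - 1 / 2) ^ (Q + 1) * a ((n : ℤ) - 1) := by
    intro n
    obtain ⟨n, rfl⟩ : ∃ k : ℕ, n = k.succPNat := ⟨n.natPred, by simp⟩
    have h := NBar_eq_poleSeries hβ1 hB P n
    have e1 : (1 : ℤ) - (n + 1 : ℕ) = -n := by push_cast; ring
    have e2 : ((n + 1 : ℕ) : ℤ) - 1 = n := by push_cast; ring
    have e3 : ((n + 1 : ℕ) : ℂ) - 1 / 2 = -half (-n) := by simp [half]; ring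
    rw [Nat.succPNat_coe, Nat.succ_eq_add_one, h, e1, e2, e3, abs_neg, Nat.abs_cast,
      div_eq_mul_inv, ← neg_one_pow_mul_inv_pow, pow_add (-1 : ℂ) (P + 1)]
    ring
  have hsgn := neg_one_pow_mul_self (P + 1 + (Q + 1))
  have sBar := ((summable_int_one_sub_pnat hs).mul_left ((-1) ^ (P + 1 + (Q + 1)))).congr eNBar
  refine ⟨sBar, (summable_int_pnat hs).congr eN, ?_, ?_⟩
  · intro k hk
    have hk' := Finset.mem_range.mp hk
    cases k with
    | zero =>
      exact (summable_mul_S_one hα1 hα0 hβ1 hA hA' hB Q _ hQ hαβ' (by omega)).1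
    | succ k =>
      exact (summable_mul_S hα1 hα0 hA hA' hB Q _ k hαβ' (by omega)).1
  have e1 : ∑ k ∈ Finset.range (P + 1), (Nat.choose (P + 1 + (Q + 1) - k - 2) (Q + 1 - 1) : ℂ) *
        ∑' n : ℕ+, b n * S a (n + 1) (k + 1) / (n : ℂ) ^ (P + 1 + (Q + 1) - k - 1) =
      (P + Q).choose Q * ∑' n : ℕ+, b n * S a (n + 1) 1 / (n : ℂ) ^ (P + Q + 1) +
        ∑ k ∈ Finset.range P, ((P + Q - k - 1).choose Q : ℂ) *
          ∑' n : ℕ+, b n * S a (n + 1) (k + 2) / (n : ℂ) ^ (P + Q - k) := by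
    rw [Finset.sum_range_succ', add_comm]
    congr 1
    · rw [show P + 1 + (Q + 1) - 0 - 2 = P + Q by omega,
        show P + 1 + (Q + 1) - 0 - 1 = P + Q + 1 by omega, Nat.add_sub_cancel]
    · refine Finset.sum_congr rfl fun k _ => ?_
      rw [show P + 1 + (Q + 1) - (k + 1) - 2 = P + Q - k - 1 by omega,
        show P + 1 + (Q + 1) - (k + 1) - 1 = P + Q - k by omega, Nat.add_sub_cancel]
  have e2 : ∑ k ∈ Finset.Icc 1 (Q + 1), (Nat.choose (k + (P + 1) - 2) (P + 1 - 1) : ℂ) *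
        D b (k + (P + 1) - 1) *
        ((-1) ^ (Q + 1 - k) * tHat a (Q + 1 - k + 1) - tTilde a (Q + 1 - k + 1)) =
      -(∑ k ∈ Finset.range Q, ((k + P).choose P : ℂ) * (D b (k + P + 1) * tSum a (Q + 1 - k)) +
        (P + Q).choose Q * (D b (P + Q + 1) * tSum a 1)) := by
    have e3 : ∀ k ∈ Finset.range (Q + 1),
        (Nat.choose (k + 1 + (P + 1) - 2) (P + 1 - 1) : ℂ) * D b (k + 1 + (P + 1) - 1) *
        ((-1) ^ (Q + 1 - (k + 1)) * tHat a (Q + 1 - (k + 1) + 1) -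
          tTilde a (Q + 1 - (k + 1) + 1)) =
        -(((k + P).choose P : ℂ) * (D b (k + P + 1) * tSum a (Q + 1 - k))) := by
      intro k hk
      have := Finset.mem_range.mp hk
      rw [show k + 1 + (P + 1) - 2 = k + P by omega, Nat.add_sub_cancel,
        show k + 1 + (P + 1) - 1 = k + P + 1 by omega,
        show Q + 1 - (k + 1) = Q - k by omega, show Q + 1 - k = Q - k + 1 by omega, tSum]
      ring
    rw [sum_Icc_one, Finset.sum_congr rfl e3, Finset.sum_neg_distrib, Finset.sum_range_succ,
      Nat.add_sub_cancel_left, add_comm Q P, Nat.choose_symm_add]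
  have e4 : (-1) ^ (P + 1 + (Q + 1)) * tHat a (P + 1 + (Q + 1)) + tTilde a (P + 1 + (Q + 1)) =
      tSum a (P + Q + 2) := by
    rw [show P + 1 + (Q + 1) = P + Q + 2 by ring, tSum, add_comm]
  rw [e1, e2, e4, ← tsum_congr eN, ← tsum_congr eNBar, tsum_mul_left]
  linear_combination ht + hsgn * ∑' n : ℕ+, (poleSeries b (P + 1) (half (1 - n)) *
      (half (1 - n) ^ (Q + 1))⁻¹ * a |1 - ((n : ℕ) : ℤ)|)
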